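/- Let $\rho$ be the density matrix of a two-qubit system, i.e. a positive semidefinite complex $4\times 4$ matrix with trace $1$ acting on $\mathbb{C}^2\otimes\mathbb{C}^2$, written in the standard product basis. Let $\tilde\rho=(\sigma_y\otimes\sigma_y)\,\rho^*\,(\sigma_y\otimes\sigma_y)$ be the spin-flipped matrix, where $\sigma_y=\begin{pmatrix}0&-i\\ i&0\end{pmatrix}$ and $\rho^*$ is the entrywise complex conjugate of $\rho$. The harmony of $\rho$ is $$H(\rho)=\max\bigl\{0,\;2\,\mathrm{tr}[(\rho\tilde\rho)^2]-[\mathrm{tr}(\rho\tilde\rho)]^2-8\det\rho\bigr\}.$$ The entanglement of formation of $\rho$ is $$E(\rho)=\inf\sum_{k=1}^{K}p_k\,E_v(\phi_k),$$ where the infimum is over all finite decompositions $\rho=\sum_{k=1}^K p_k|\phi_k\rangle\langle\phi_k|$ with $p_k\ge 0$, $\sum_k p_k=1$ and unit vectors $\phi_k\in\mathbb{C}^2\otimes\mathbb{C}^2$, and $E_v(\phi)=-\mathrm{tr}(\rho_A\log\rho_A)$ is the von Neumann entropy of the reduced state $\rho_A=\mathrm{tr}_B|\phi\rangle\langle\phi|$.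 The state $\rho$ is called separable if it is a finite convex combination $\sum_k p_k\,\alpha_k\otimes\beta_k$ of tensor products of one-qubit density matrices, and maximally entangled if $E(\tau)\le E(\rho)$ for every two-qubit density matrix $\tau$. Then: 1. The two qubits are separable if and only if $H(\rho)=0$; likewise $E(\rho)=0$ if and only if $H(\rho)=0$. 2. The two qubits are maximally entangled if and only if $H(\rho)=1$. -/

import Mathlib

open scoped Kronecker ComplexOrder
open Matrix

noncomputable section

/-- Complex square matrices indexed by the standard product basis `|00⟩, |01⟩, |10⟩, |11⟩` of
two qubits; the first index refers to the qubit `A` and the second one to the qubit `B`. -/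
abbrev TwoQubitMatrix : Type := Matrix (Fin 2 × Fin 2) (Fin 2 × Fin 2) ℂ

/-- A density matrix: positive semidefinite (hence Hermitian) with trace one. -/
def IsDensityMatrix {n : Type*} [Fintype n] (ρ : Matrix n n ℂ) : Prop :=
  ρ.PosSemidef ∧ ρ.trace = 1

/-- The Pauli matrix `σ_y`. -/
def pauliY : Matrix (Fin 2) (Fin 2) ℂ := !![0, -Complex.I; Complex.I, 0]

/-- The spin flip `(σ_y ⊗ σ_y) ρ^* (σ_y ⊗ σ_y)`, where `ρ^*` is the entrywise complex conjugate. -/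
def spinFlip (ρ : TwoQubitMatrix) : TwoQubitMatrix :=
  (pauliY ⊗ₖ pauliY) * ρ.map star * (pauliY ⊗ₖ pauliY)

/-- `2 tr[(ρ ρ̃)²] - [tr(ρ ρ̃)]² - 8 det ρ`, as a complex number. -/
def harmonyPoly (ρ : TwoQubitMatrix) : ℂ :=
  2 * ((ρ * spinFlip ρ) ^ 2).trace - (ρ * spinFlip ρ).trace ^ 2 - 8 * ρ.det

/-- The harmony `H(ρ)`. The real part is harmless: see `harmonyPoly_im`. -/
def harmony (ρ : TwoQubitMatrix) : ℝ :=
  max 0 (harmonyPoly ρ).re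

theorem spinFlip_isHermitian {ρ : TwoQubitMatrix} (h : ρ.IsHermitian) :
    (spinFlip ρ).IsHermitian := by
  have hy : pauliYᴴ = pauliY := by
    ext i j
    fin_cases i <;> fin_cases j <;> simp [pauliY]
  have hm : (ρ.map star)ᴴ = ρ.map star := by
    ext i j
    have := congrFun (congrFun h i) j
    simp only [conjTranspose_apply, map_apply] at this ⊢
    rw [this]
  unfold spinFlip Matrix.IsHermitian
  simp only [conjTranspose_mul, conjTranspose_kronecker, hy, hm, Matrix.mul_assoc]

/-- The expression inside the harmony is real for Hermitian matrices. -/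
theorem harmonyPoly_im {ρ : TwoQubitMatrix} (h : ρ.IsHermitian) : (harmonyPoly ρ).im = 0 := by
  have hs := spinFlip_isHermitian h
  have h1 : star (ρ * spinFlip ρ).trace = (ρ * spinFlip ρ).trace := by
    rw [← trace_conjTranspose, conjTranspose_mul, h.eq, hs.eq, trace_mul_comm]
  have h2 : star ((ρ * spinFlip ρ) ^ 2).trace = ((ρ * spinFlip ρ) ^ 2).trace := by
    rw [← trace_conjTranspose, conjTranspose_pow, conjTranspose_mul, h.eq, hs.eq, pow_two, pow_two,
      Matrix.mul_assoc, trace_mul_comm, Matrix.mul_assoc, Matrix.mul_assoc, Matrix.mul_assoc]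
  have h3 : star ρ.det = ρ.det := by
    rw [← det_conjTranspose, h.eq]
  have h4 : star (harmonyPoly ρ) = harmonyPoly ρ := by
    simp only [harmonyPoly, star_sub, star_mul', star_pow, h1, h2, h3, star_ofNat]
  exact Complex.conj_eq_iff_im.mp h4

/-- A two-qubit state is separable if it is a finite convex combination of product states. -/
def IsSeparableState (ρ : TwoQubitMatrix) : Prop :=
  ∃ (K : ℕ) (p : Fin K → ℝ) (α β : Fin K → Matrix (Fin 2) (Fin 2) ℂ),
    (∀ k, 0 ≤ p k) ∧ ∑ k, p k = 1 ∧
    (∀ k, IsDensityMatrix (α k)) ∧ (∀ k, IsDensityMatrix (β k)) ∧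
    ρ = ∑ k, (p k : ℂ) • (α k ⊗ₖ β k)

/-- The projector `|φ⟩⟨φ|`. -/
def pureState {n : Type*} (φ : n → ℂ) : Matrix n n ℂ := vecMulVec φ (star φ)

/-- The reduced matrix of the qubit `A`: the partial trace over the qubit `B`. -/
def partialTraceB (M : TwoQubitMatrix) : Matrix (Fin 2) (Fin 2) ℂ :=
  Matrix.of fun i j => ∑ k, M (i, k) (j, k)

theorem partialTraceB_pureState_isHermitian (φ : Fin 2 × Fin 2 → ℂ) :
    (partialTraceB (pureState φ)).IsHermitian := by
  ext i j
  simp [partialTraceB, pureState, vecMulVec_apply, mul_comm]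

/-- The von Neumann entropy `-tr(A log A)` of a Hermitian matrix, that is, the sum of `-x log x`
over its eigenvalues `x` with multiplicity (natural logarithm, `0 log 0 = 0`). -/
def vonNeumannEntropy {n : Type*} [Fintype n] [DecidableEq n] (A : Matrix n n ℂ)
    (hA : A.IsHermitian) : ℝ :=
  ∑ i, Real.negMulLog (hA.eigenvalues i)

/-- The entanglement entropy `E_v(φ)` of a pure state: the von Neumann entropy of the reduced
state of the qubit `A`. -/
def entanglementEntropy (φ : Fin 2 × Fin 2 → ℂ) : ℝ :=
  vonNeumannEntropy (partialTraceB (pureState φ)) (partialTraceB_pureState_isHermitian φ)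

/-- `ρ = ∑ₖ pₖ |φₖ⟩⟨φₖ|` with probabilities `pₖ` summing to one and unit vectors `φₖ`. -/
def IsPureDecomposition (ρ : TwoQubitMatrix) {K : ℕ} (p : Fin K → ℝ)
    (φ : Fin K → Fin 2 × Fin 2 → ℂ) : Prop :=
  (∀ k, 0 ≤ p k) ∧ ∑ k, p k = 1 ∧ (∀ k, ∑ i, ‖φ k i‖ ^ 2 = 1) ∧
    ρ = ∑ k, (p k : ℂ) • pureState (φ k)

/-- The entanglement of formation `E(ρ)`: the least average entanglement entropy over all pure
state decompositions of `ρ`, of any finite length. -/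
def entanglementOfFormation (ρ : TwoQubitMatrix) : ℝ :=
  sInf {e : ℝ | ∃ (K : ℕ) (p : Fin K → ℝ) (φ : Fin K → Fin 2 × Fin 2 → ℂ),
    IsPureDecomposition ρ p φ ∧ e = ∑ k, p k * entanglementEntropy (φ k)}

/-- A two-qubit state is maximally entangled if its entanglement of formation is the largest one
among all two-qubit states. -/
def IsMaximallyEntangled (ρ : TwoQubitMatrix) : Prop :=
  IsDensityMatrix ρ ∧
    ∀ τ : TwoQubitMatrix, IsDensityMatrix τ →
      entanglementOfFormation τ ≤ entanglementOfFormation ρ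

end

/-! The proof follows Wootters. Takagi factorization yields `ρ = V * Vᴴ` whose columns diagonalize
the concurrence form, with values `l i ≥ 0`, the largest at index `0`. In these values the harmony
polynomial is a product of four linear factors; three are nonnegative because `l 0` is largest, so
its sign is decided by `C = l 0 - l (0, 1) - l (1, 0) - l (1, 1)`.

`C` bounds from below the average concurrence of every decomposition (`le_sum_norm_concForm`). If `C
≤ 0`, phases closing a quadrilateral with sides `l i` give a decomposition into product vectors
(`exists_decomposition_concForm_eq_zero`). Since a pure state of concurrence `c` has entropy at
least `c ^ 2 / 2`, and zero if `c = 0`, this settles the first claim.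

The largest possible `E` is `log 2`, reached by a Bell state. If `E = log 2`, every decomposition
has total concurrence `1`; two choices of phases then force `l = (1, 0, 0, 0)`. Conversely, `∑ l i ≤
1` keeps each factor at most `1`, so `H = 1` gives `C ≥ 1`, and every pure state of positive weight
has entropy `log 2`. -/

/-! ### Takagi factorization of complex symmetric matrices -/

/-- A symmetric conjugate-linear operator has, in each nonzero invariant subspace, a unit vector
which it multiplies by a nonnegative real number. -/
theorem exists_unit_eigenvector_of_antilinear {E : Type*} [NormedAddCommGroup E]
    [InnerProductSpace ℂ E] [FiniteDimensional ℂ E] (A : E →ₗ⋆[ℂ] E)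
    (hA : ∀ x y, inner ℂ (A x) y = inner ℂ (A y) x) (W : Submodule ℂ E)
    (hW : ∀ x ∈ W, A x ∈ W) (hne : W ≠ ⊥) :
    ∃ z ∈ W, ‖z‖ = 1 ∧ ∃ l : ℝ, 0 ≤ l ∧ A z = (l : ℂ) • z := by
  -- The square of a conjugate-linear map is linear, so it has an eigenvalue on `W`; the symmetry
  -- `hA` makes that eigenvalue `l ^ 2`.
  let B : E →ₗ[ℂ] E := A.comp A
  have hB : ∀ x ∈ W, B x ∈ W := fun x hx => hW _ (hW x hx)
  have : Nontrivial W := Submodule.nontrivial_iff_ne_bot.mpr hne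
  obtain ⟨μ, hμ⟩ := Module.End.exists_eigenvalue (B.restrict hB)
  obtain ⟨⟨x, hxW⟩, hx⟩ := hμ.exists_hasEigenvector
  have hx0 : x ≠ 0 := fun h => hx.2 (Subtype.ext h)
  have hAA : A (A x) = μ • x := congrArg Subtype.val hx.apply_eq_smul
  have hxn : 0 < ‖x‖ := norm_pos_iff.mpr hx0
  have hμr : μ = ((‖A x‖ ^ 2 / ‖x‖ ^ 2 : ℝ) : ℂ) := by
    have h1 : inner ℂ (A (A x)) x = inner ℂ (A x) (A x) := hA _ _
    rw [hAA, inner_smul_left, inner_self_eq_norm_sq_to_K, inner_self_eq_norm_sq_to_K] at h1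
    have h2 := congrArg (starRingEnd ℂ) h1
    simp only [map_mul, map_pow, Complex.conj_conj] at h2
    have h3 : ((‖x‖ : ℝ) : ℂ) ≠ 0 := by exact_mod_cast hxn.ne'
    push_cast
    rw [eq_div_iff (pow_ne_zero 2 h3)]
    simpa using h2
  set l : ℝ := ‖A x‖ / ‖x‖ with hl
  have hl0 : 0 ≤ l := by positivity
  have hμl : μ = (l : ℂ) * l := by rw [hμr, hl]; push_cast; ring
  -- `A x + l • x` is fixed up to the factor `l`. If it vanishes, then `A x = -l • x`, and
  -- multiplying `x` by `I` flips the sign.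
  have key : ∃ z ∈ W, z ≠ 0 ∧ A z = (l : ℂ) • z := by
    by_cases hz : A x + (l : ℂ) • x = 0
    · refine ⟨Complex.I • x, W.smul_mem _ hxW, smul_ne_zero Complex.I_ne_zero hx0, ?_⟩
      have : A x = -((l : ℂ) • x) := eq_neg_of_add_eq_zero_left hz
      rw [LinearMap.map_smulₛₗ, this, Complex.conj_I, smul_neg, neg_smul, neg_neg, smul_comm]
    · refine ⟨_, W.add_mem (hW x hxW) (W.smul_mem _ hxW), hz, ?_⟩
      rw [map_add, LinearMap.map_smulₛₗ, hAA, Complex.conj_ofReal, smul_add, smul_smul, ← hμl,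
        add_comm]
  obtain ⟨z, hzW, hz0, hz⟩ := key
  refine ⟨((‖z‖⁻¹ : ℝ) : ℂ) • z, W.smul_mem _ hzW, ?_, l, hl0, ?_⟩
  · rw [norm_smul, Complex.norm_real, norm_inv, norm_norm, inv_mul_cancel₀ (norm_ne_zero_iff.mpr hz0)]
  · rw [LinearMap.map_smulₛₗ, hz, Complex.conj_ofReal, smul_comm]

/-- Induction on `k`: by symmetry of `A`, the orthogonal complement of the eigenvectors already
found is invariant. -/
theorem exists_orthonormal_eigenvectors_of_antilinear {E : Type*} [NormedAddCommGroup E]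
    [InnerProductSpace ℂ E] [FiniteDimensional ℂ E] (A : E →ₗ⋆[ℂ] E)
    (hA : ∀ x y, inner ℂ (A x) y = inner ℂ (A y) x) (k : ℕ) (hk : k ≤ Module.finrank ℂ E) :
    ∃ (v : Fin k → E) (l : Fin k → ℝ), Orthonormal ℂ v ∧
      ∀ i, 0 ≤ l i ∧ A (v i) = (l i : ℂ) • v i := by
  induction k with
  | zero => exact ⟨Fin.elim0, Fin.elim0, ⟨fun i => i.elim0, fun i => i.elim0⟩, fun i => i.elim0⟩
  | succ k ih =>
    obtain ⟨v, l, hv, hl⟩ := ih (by omega)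
    set S := Submodule.span ℂ (Set.range v) with hS
    have hSr : Module.finrank ℂ S = k := by
      rw [hS, finrank_span_eq_card hv.linearIndependent, Fintype.card_fin]
    have hmem : ∀ x, x ∈ Sᗮ ↔ ∀ i, inner ℂ (v i) x = 0 := by
      intro x
      refine ⟨fun h i => h _ (Submodule.subset_span ⟨i, rfl⟩), fun h => ?_⟩
      rw [Submodule.mem_orthogonal]
      intro u hu
      induction hu using Submodule.span_induction with
      | mem u hu => obtain ⟨i, rfl⟩ := hu; exact h i
      | zero => exact inner_zero_left _
      | add u w _ _ hu hw => rw [inner_add_left, hu, hw, add_zero]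
      | smul a u _ hu => rw [inner_smul_left, hu, mul_zero]
    have hne : Sᗮ ≠ ⊥ := by
      intro h
      have := S.finrank_add_finrank_orthogonal
      rw [h, finrank_bot, hSr] at this
      omega
    have hinv : ∀ x ∈ Sᗮ, A x ∈ Sᗮ := by
      intro x hx
      rw [hmem] at hx ⊢
      intro i
      rw [← inner_conj_symm, hA, (hl i).2, inner_smul_left, hx i, mul_zero, map_zero]
    obtain ⟨z, hzS, hz1, m, hm, hz⟩ :=
      exists_unit_eigenvector_of_antilinear A hA _ hinv hne
    rw [hmem] at hzS
    refine ⟨Fin.cons z v, Fin.cons m l, ⟨?_, ?_⟩, ?_⟩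
    · exact Fin.cases hz1 hv.1
    · intro i j
      refine Fin.cases ?_ (fun i => ?_) i <;> refine Fin.cases ?_ (fun j => ?_) j
      · exact fun h => (h rfl).elim
      · intro _
        rw [Fin.cons_zero, Fin.cons_succ, ← inner_conj_symm, hzS, map_zero]
      · intro _
        rw [Fin.cons_zero, Fin.cons_succ, hzS]
      · intro h
        rw [Fin.cons_succ, Fin.cons_succ]
        exact hv.2 fun h' => h (congrArg _ h')
    · exact Fin.cases ⟨hm, hz⟩ hl

/-- **Takagi factorization**: a complex symmetric matrix is unitarily congruent to a diagonal
matrix with nonnegative entries. -/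
theorem Matrix.exists_takagi {n : Type*} [Fintype n] [DecidableEq n] (T : Matrix n n ℂ)
    (hT : Tᵀ = T) : ∃ (U : Matrix n n ℂ) (l : n → ℝ), U * Uᴴ = 1 ∧ (∀ i, 0 ≤ l i) ∧
      Uᵀ * T * U = diagonal fun i => (l i : ℂ) := by
  -- For the map `x ↦ T x̄`, an orthonormal eigenbasis `Z` satisfies `T Z̄ = Z diag(l)`, so `U = Z̄`
  -- works.
  let A : EuclideanSpace ℂ n →ₗ⋆[ℂ] EuclideanSpace ℂ n :=
    { toFun := fun x => WithLp.toLp 2 (T *ᵥ star x.ofLp)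
      map_add' := fun x y => by simp [mulVec_add]
      map_smul' := fun a x => by simp [mulVec_smul] }
  have hA : ∀ x y, inner ℂ (A x) y = inner ℂ (A y) x := by
    intro x y
    simp only [EuclideanSpace.inner_eq_star_dotProduct, A, LinearMap.coe_mk, AddHom.coe_mk]
    have hT' : Tᴴᵀ = Tᴴ := by
      conv_rhs => rw [← hT]
      rfl
    rw [star_mulVec, star_mulVec, star_star, star_star, dotProduct_comm, ← dotProduct_mulVec,
      ← mulVec_transpose, hT', dotProduct_comm, dotProduct_comm (Tᴴ *ᵥ y.ofLp)]
  obtain ⟨v, l, hv, hl⟩ := exists_orthonormal_eigenvectors_of_antilinear A hA (Fintype.card n)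
    (by simp)
  let e := Fintype.equivFin n
  let Z : Matrix n n ℂ := of fun i j => v (e j) i
  have hZ : Zᴴ * Z = 1 := by
    ext i j
    have := orthonormal_iff_ite.mp hv (e i) (e j)
    rw [EuclideanSpace.inner_eq_star_dotProduct, dotProduct_comm] at this
    simpa [mul_apply, Z, dotProduct, one_apply] using this
  have hTZ : T * Z.map star = Z * diagonal fun i => (l (e i) : ℂ) := by
    ext i j
    have := congrFun (congrArg WithLp.ofLp (hl (e j)).2) i
    rw [mul_diagonal]
    simpa [A, mul_apply, Z, mulVec, dotProduct, mul_comm] using this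
  refine ⟨Z.map star, fun i => l (e i), ?_, fun i => (hl _).1, ?_⟩
  · have h := congrArg (fun M => M.map star) (mul_eq_one_comm.mp hZ)
    ext i j
    have := congrFun (congrFun h i) j
    simpa [mul_apply, one_apply, mul_comm, apply_ite] using this
  · rw [Matrix.mul_assoc, hTZ, ← Matrix.mul_assoc, show (Z.map star)ᵀ = Zᴴ from rfl, hZ,
      Matrix.one_mul]

/-! ### The concurrence form -/

/-- The matrix `σ_y ⊗ σ_y`. -/
def spinY : TwoQubitMatrix := pauliY ⊗ₖ pauliY

theorem spinY_transpose : spinYᵀ = spinY := by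
  ext ⟨a, b⟩ ⟨c, d⟩
  fin_cases a <;> fin_cases b <;> fin_cases c <;> fin_cases d <;> simp [spinY, pauliY]

theorem spinY_map_star : spinY.map star = spinY := by
  ext ⟨a, b⟩ ⟨c, d⟩
  fin_cases a <;> fin_cases b <;> fin_cases c <;> fin_cases d <;> simp [spinY, pauliY]

theorem spinY_det : spinY.det = 1 := by
  simp [spinY, pauliY, det_kronecker, det_fin_two]

/-- The quadratic form `⟨φ^*|σ_y ⊗ σ_y|φ⟩`, whose modulus is the concurrence of `φ`. -/
def concForm (φ : Fin 2 × Fin 2 → ℂ) : ℂ := φ ⬝ᵥ spinY *ᵥ φ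

theorem concForm_eq (φ : Fin 2 × Fin 2 → ℂ) :
    concForm φ = 2 * (φ (0, 1) * φ (1, 0) - φ (0, 0) * φ (1, 1)) := by
  simp [concForm, spinY, pauliY, dotProduct, mulVec, Fintype.sum_prod_type]
  ring

theorem concForm_smul (a : ℂ) (φ : Fin 2 × Fin 2 → ℂ) :
    concForm (a • φ) = a ^ 2 * concForm φ := by
  simp only [concForm_eq, Pi.smul_apply, smul_eq_mul]
  ring

theorem norm_concForm_le (φ : Fin 2 × Fin 2 → ℂ) : ‖concForm φ‖ ≤ ∑ i, ‖φ i‖ ^ 2 := by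
  rw [concForm_eq, norm_mul, Complex.norm_ofNat]
  have h := norm_sub_le (φ (0, 1) * φ (1, 0)) (φ (0, 0) * φ (1, 1))
  simp only [norm_mul] at h
  simp only [Fintype.sum_prod_type, Fin.sum_univ_two]
  nlinarith [sq_nonneg (‖φ (0, 1)‖ - ‖φ (1, 0)‖), sq_nonneg (‖φ (0, 0)‖ - ‖φ (1, 1)‖)]

theorem sum_pureState_col {n : Type*} [Fintype n] (V : Matrix n n ℂ) :
    ∑ k, pureState (fun i => V i k) = V * Vᴴ := by
  ext i j
  simp [pureState, Matrix.sum_apply, vecMulVec_apply, mul_apply]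

theorem trace_pureState {n : Type*} [Fintype n] (φ : n → ℂ) :
    (pureState φ).trace = ((∑ i, ‖φ i‖ ^ 2 : ℝ) : ℂ) := by
  simp [pureState, trace, vecMulVec_apply, Complex.mul_conj']

theorem pureState_smul {n : Type*} (a : ℂ) (φ : n → ℂ) :
    pureState (a • φ) = ((‖a‖ ^ 2 : ℝ) : ℂ) • pureState φ := by
  ext i j
  simp only [pureState, vecMulVec_apply, Pi.smul_apply, Pi.star_apply, smul_eq_mul, Matrix.smul_apply,
    star_mul', Complex.ofReal_pow, ← Complex.mul_conj']
  simp only [RCLike.star_def]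
  ring

open scoped MatrixOrder in
theorem Matrix.PosSemidef.exists_eq_mul_conjTranspose {n : Type*} [Fintype n] [DecidableEq n]
    {A : Matrix n n ℂ} (hA : A.PosSemidef) : ∃ B : Matrix n n ℂ, A = B * Bᴴ :=
  CStarAlgebra.nonneg_iff_eq_mul_star_self.mp hA.nonneg

/-- A decomposition of a two-qubit state into subnormalized pure states, the columns of `V`, which
diagonalizes the concurrence form. -/
structure IsWoottersBasis (ρ V : TwoQubitMatrix) (l : Fin 2 × Fin 2 → ℝ) : Prop where
  eq_mul : ρ = V * Vᴴ
  diag : Vᵀ * spinY * V = diagonal fun i => (l i : ℂ)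
  nonneg : ∀ i, 0 ≤ l i
  le_zero : ∀ i, l i ≤ l 0

/-- For `ρ = B * Bᴴ`, replacing `B` by `B * U` with `U` unitary keeps the product, so the Takagi
unitary of `Bᵀ * spinY * B` can be absorbed. Swapping two columns moves the largest value to index
`0`. -/
theorem exists_isWoottersBasis {ρ : TwoQubitMatrix} (hρ : ρ.PosSemidef) :
    ∃ V l, IsWoottersBasis ρ V l := by
  obtain ⟨B, hB⟩ := hρ.exists_eq_mul_conjTranspose
  obtain ⟨U, l, hU, hl, hd⟩ := Matrix.exists_takagi (Bᵀ * spinY * B) (by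
    simp only [transpose_mul, transpose_transpose, spinY_transpose, Matrix.mul_assoc])
  obtain ⟨m, hm⟩ := Finite.exists_max l
  let e : Equiv.Perm (Fin 2 × Fin 2) := Equiv.swap 0 m
  have h1 : ρ = (B * U) * (B * U)ᴴ := by
    rw [conjTranspose_mul, Matrix.mul_assoc, ← Matrix.mul_assoc U, hU, Matrix.one_mul, hB]
  have h2 : (B * U)ᵀ * spinY * (B * U) = diagonal fun i => (l i : ℂ) := by
    rw [← hd, transpose_mul]; simp only [Matrix.mul_assoc]
  refine ⟨(B * U).submatrix id e, l ∘ e, ?_, ?_, fun i => hl _, fun i => ?_⟩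
  · rw [conjTranspose_submatrix, submatrix_mul_equiv, ← h1, submatrix_id_id]
  · have := congrArg (fun M => M.submatrix e e) h2
    simp only [submatrix_diagonal_equiv] at this
    rw [transpose_submatrix]
    refine Eq.trans ?_ this
    ext i j
    simp [mul_apply]
  · simpa [e] using hm (e i)

/-- Cyclicity of the trace turns the traces into those of `D ^ 2` and `D ^ 4`. Since `spinY` has
determinant one, `det ρ = |det V| ^ 2 = |det D| = ∏ l i`. -/
theorem IsWoottersBasis.harmonyPoly_eq {ρ V : TwoQubitMatrix} {l : Fin 2 × Fin 2 → ℝ}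
    (h : IsWoottersBasis ρ V l) : harmonyPoly ρ =
      (((l 0 - l (0, 1) - l (1, 0) - l (1, 1)) * (l 0 + l (0, 1) + l (1, 0) - l (1, 1)) *
        (l 0 + l (0, 1) - l (1, 0) + l (1, 1)) * (l 0 - l (0, 1) + l (1, 0) + l (1, 1)) : ℝ) : ℂ) := by
  set D : TwoQubitMatrix := diagonal fun i => (l i : ℂ) with hD
  have hDs : Dᴴ = D := by
    rw [hD, diagonal_conjTranspose]
    congr 1
    ext i
    exact Complex.conj_ofReal _
  have hYs : spinYᴴ = spinY := by
    rw [conjTranspose, spinY_transpose, spinY_map_star]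
  have hd2 : Vᴴ * (spinY * V.map star) = D := by
    rw [← hDs, hD, ← h.diag, conjTranspose_mul, conjTranspose_mul, hYs]
    rfl
  have hsf : ρ * spinFlip ρ = V * (D * (Vᵀ * spinY)) := by
    have : ρ.map star = V.map star * Vᵀ := by
      have h1 : ρᴴ = ρ := by rw [h.eq_mul, conjTranspose_mul, conjTranspose_conjTranspose]
      calc ρ.map star = ρᴴᵀ := rfl
        _ = V.map star * Vᵀ := by
          rw [h1, h.eq_mul, transpose_mul]
          ext i j
          simp [mul_apply, mul_comm]
    rw [spinFlip, this, ← hd2]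
    nth_rw 1 [h.eq_mul]
    simp only [Matrix.mul_assoc, ← spinY.eq_def]
  have hX : D * (Vᵀ * spinY) * V = D * D := by
    rw [Matrix.mul_assoc, h.diag]
  have ht : (ρ * spinFlip ρ).trace = (D * D).trace := by
    rw [hsf, trace_mul_comm, hX]
  have ht2 : ((ρ * spinFlip ρ) ^ 2).trace = (D * D * (D * D)).trace := by
    rw [hsf, pow_two, Matrix.mul_assoc, trace_mul_comm, ← Matrix.mul_assoc, hX, Matrix.mul_assoc,
      hX]
  have hdet : ρ.det = D.det := by
    have h1 : D.det = V.det ^ 2 := by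
      rw [hD, ← h.diag, det_mul, det_mul, det_transpose, spinY_det]; ring
    have h2 : D.det = ((∏ i, l i : ℝ) : ℂ) := by
      rw [hD, det_diagonal]; push_cast; rfl
    have h3 : ‖D.det‖ = ∏ i, l i := by
      rw [h2, Complex.norm_real, Real.norm_of_nonneg (Finset.prod_nonneg fun i _ => h.nonneg i)]
    rw [h.eq_mul, det_mul, det_conjTranspose, RCLike.star_def, Complex.mul_conj', h2, ← h3, h1,
      norm_pow]
    push_cast
    rfl
  rw [harmonyPoly, ht, ht2, hdet, hD]
  simp only [diagonal_mul_diagonal, trace_diagonal, det_diagonal, Fintype.sum_prod_type,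
    Fintype.prod_prod_type, Fin.sum_univ_two, Fin.prod_univ_two]
  rw [show (0 : Fin 2 × Fin 2) = (0, 0) from rfl]
  push_cast
  ring

/-! ### Lower bound for the average concurrence -/

theorem pureState_mulVec {n : Type*} [Fintype n] (G : Matrix n n ℂ) (φ : n → ℂ) :
    pureState (G *ᵥ φ) = G * pureState φ * Gᴴ := by
  rw [pureState, pureState, mul_vecMulVec, vecMulVec_mul, star_mulVec]

/-- If `x` is orthogonal to the range of `V`, then `∑ |⟨w j, x⟩| ^ 2 = ⟨x, V Vᴴ x⟩ = 0`; hence `w k`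
lies in the double orthogonal complement of the range. -/
theorem exists_eq_mulVec_of_sum_pureState {n ι : Type*} [Fintype n] [DecidableEq n] [Fintype ι]
    {V : Matrix n n ℂ} {w : ι → n → ℂ} (h : V * Vᴴ = ∑ k, pureState (w k)) (k : ι) :
    ∃ u, w k = V *ᵥ u := by
  let S := LinearMap.range (Matrix.toEuclideanLin V)
  have hmem : WithLp.toLp 2 (w k) ∈ Sᗮᗮ := by
    rw [Submodule.mem_orthogonal]
    intro x hx
    rw [Submodule.mem_orthogonal'] at hx
    have h0 := hx _ ⟨WithLp.toLp 2 (Vᴴ *ᵥ x.ofLp), rfl⟩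
    rw [EuclideanSpace.inner_eq_star_dotProduct] at h0 ⊢
    simp only [toLpLin_toLp, toLin'_apply, mulVec_mulVec, h] at h0
    have h1 : (∑ k, pureState (w k)) *ᵥ x.ofLp ⬝ᵥ star x.ofLp
        = ((∑ k, ‖w k ⬝ᵥ star x.ofLp‖ ^ 2 : ℝ) : ℂ) := by
      rw [sum_mulVec, sum_dotProduct]
      push_cast
      refine Finset.sum_congr rfl fun j _ => ?_
      rw [pureState, vecMulVec_mulVec, ← Complex.mul_conj', ← RCLike.star_def,
        dotProduct_comm (w j) (star _), ← star_dotProduct, op_smul_eq_smul, smul_dotProduct,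
        smul_eq_mul, mul_comm, dotProduct_comm (w j)]
    rw [h1] at h0
    have h2 := (Finset.sum_eq_zero_iff_of_nonneg fun j _ => by positivity).mp
      (Complex.ofReal_eq_zero.mp h0) k (Finset.mem_univ k)
    exact norm_eq_zero.mp (pow_eq_zero_iff two_ne_zero |>.mp h2)
  rw [Submodule.orthogonal_orthogonal] at hmem
  obtain ⟨u, hu⟩ := hmem
  exact ⟨u.ofLp, (congrArg WithLp.ofLp hu).symm⟩

/-- With `w k = V *ᵥ u k`, the concurrence form is `∑ i, l i * u k i ^ 2`. The reverse triangle
inequality is applied for each `k` and summed. -/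
theorem IsWoottersBasis.le_sum_norm_concForm {ρ V : TwoQubitMatrix} {l : Fin 2 × Fin 2 → ℝ}
    (h : IsWoottersBasis ρ V l) {ι : Type*} [Fintype ι] {w : ι → Fin 2 × Fin 2 → ℂ}
    (hw : ρ = ∑ k, pureState (w k)) :
    l 0 - l (0, 1) - l (1, 0) - l (1, 1) ≤ ∑ k, ‖concForm (w k)‖ := by
  choose u hu using exists_eq_mulVec_of_sum_pureState (h.eq_mul.symm.trans hw)
  have hG : ∀ k i, ((Vᵀ * spinY) *ᵥ w k) i = l i * u k i := by
    intro k i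
    rw [hu, mulVec_mulVec, h.diag, mulVec_diagonal]
  have hc : ∀ k, concForm (w k) = ∑ i, l i * u k i ^ 2 := by
    intro k
    have : concForm (w k) = u k ⬝ᵥ (Vᵀ * spinY) *ᵥ w k := by
      rw [concForm]
      nth_rw 1 [hu]
      rw [← mulVec_mulVec, dotProduct_mulVec (u k), vecMul_transpose]
    rw [this, dotProduct]
    refine Finset.sum_congr rfl fun i _ => ?_
    rw [hG]; ring
  -- `V` may be singular and `u k` is then not unique; only `l i * u k i` is determined by `w k`, so
  -- the normalization is claimed only after weighting by `l i`.
  have hs : ∀ i, l i * ∑ k, ‖u k i‖ ^ 2 = l i := by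
    intro i
    have h1 : ∑ k, pureState ((Vᵀ * spinY) *ᵥ w k) = diagonal fun i => ((l i ^ 2 : ℝ) : ℂ) := by
      simp only [pureState_mulVec]
      have h3 : Vᵀ * spinY * (V * Vᴴ) * (Vᵀ * spinY)ᴴ
          = (Vᵀ * spinY * V) * (Vᵀ * spinY * V)ᴴ := by
        rw [conjTranspose_mul (Vᵀ * spinY) V]
        simp only [Matrix.mul_assoc]
      rw [← Finset.sum_mul, ← Finset.mul_sum, ← hw, h.eq_mul, h3, h.diag, diagonal_conjTranspose,
        diagonal_mul_diagonal]
      congr 1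
      ext i
      simp [pow_two]
    have h2 : l i ^ 2 * ∑ k, ‖u k i‖ ^ 2 = l i ^ 2 := by
      have := congrFun (congrFun h1 i) i
      rw [Matrix.sum_apply, diagonal_apply_eq] at this
      simp only [pureState, vecMulVec_apply, Pi.star_apply, RCLike.star_def, Complex.mul_conj',
        hG, norm_mul, Complex.norm_real, Real.norm_of_nonneg (h.nonneg i)] at this
      rw [Finset.mul_sum]
      simp only [← mul_pow]
      exact_mod_cast this
    rcases (h.nonneg i).eq_or_lt with h0 | h0
    · rw [← h0, zero_mul]
    · have : l i * (l i * ∑ k, ‖u k i‖ ^ 2) = l i * l i := by linarith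
      exact mul_left_cancel₀ h0.ne' this
  have hb : ∀ k, l 0 * ‖u k 0‖ ^ 2 - l (0, 1) * ‖u k (0, 1)‖ ^ 2 - l (1, 0) * ‖u k (1, 0)‖ ^ 2
      - l (1, 1) * ‖u k (1, 1)‖ ^ 2 ≤ ‖concForm (w k)‖ := by
    intro k
    have hn : ∀ i, ‖(l i : ℂ) * u k i ^ 2‖ = l i * ‖u k i‖ ^ 2 := fun i => by
      rw [norm_mul, norm_pow, Complex.norm_real, Real.norm_of_nonneg (h.nonneg i)]
    simp only [← hn]
    rw [hc]
    simp only [Fintype.sum_prod_type, Fin.sum_univ_two]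
    rw [show (0 : Fin 2 × Fin 2) = (0, 0) from rfl]
    set a := (l (0, 0) : ℂ) * u k (0, 0) ^ 2
    set b := (l (0, 1) : ℂ) * u k (0, 1) ^ 2
    set c := (l (1, 0) : ℂ) * u k (1, 0) ^ 2
    set d := (l (1, 1) : ℂ) * u k (1, 1) ^ 2
    have h1 := norm_sub_le (a + b + (c + d)) (b + (c + d))
    have h2 := norm_add_le b (c + d)
    have h3 := norm_add_le c d
    rw [show a + b + (c + d) - (b + (c + d)) = a by ring] at h1
    linarith
  calc l 0 - l (0, 1) - l (1, 0) - l (1, 1)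
      = ∑ k, (l 0 * ‖u k 0‖ ^ 2 - l (0, 1) * ‖u k (0, 1)‖ ^ 2 - l (1, 0) * ‖u k (1, 0)‖ ^ 2
      - l (1, 1) * ‖u k (1, 1)‖ ^ 2) := by
        simp only [Finset.sum_sub_distrib, ← Finset.mul_sum, hs]
    _ ≤ _ := Finset.sum_le_sum fun k _ => hb k

/-! ### Decompositions with constant concurrence form -/

theorem concForm_col (V : TwoQubitMatrix) (k : Fin 2 × Fin 2) :
    concForm (fun i => V i k) = (Vᵀ * spinY * V) k k := by
  rw [concForm, Matrix.mul_assoc]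
  rfl

/-- The columns of `V` are mixed by the unitary `R`, a diagonal of phases times half of a `4 × 4`
Hadamard matrix. Its entries `±1` disappear on squaring, so every new column gets the same form
value. -/
theorem IsWoottersBasis.exists_decomposition_of_phases {ρ V : TwoQubitMatrix}
    {l : Fin 2 × Fin 2 → ℝ} (h : IsWoottersBasis ρ V l) (z : Fin 2 × Fin 2 → ℂ)
    (hz : ∀ i, ‖z i‖ = 1) : ∃ w : Fin 2 × Fin 2 → Fin 2 × Fin 2 → ℂ,
      ρ = ∑ k, pureState (w k) ∧ ∀ k, concForm (w k) = (∑ i, z i ^ 2 * l i) / 4 := by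
  let s : Matrix (Fin 2) (Fin 2) ℂ := !![1, 1; 1, -1]
  let R : TwoQubitMatrix := diagonal z * ((2⁻¹ : ℂ) • (s ⊗ₖ s))
  have hss : s * sᴴ = (2 : ℂ) • 1 := by
    ext i j
    fin_cases i <;> fin_cases j <;> simp [s, mul_apply, Fin.sum_univ_two] <;> norm_num
  have hzz : diagonal z * (diagonal z)ᴴ = 1 := by
    have : (fun i => z i * star z i) = 1 := by
      ext i
      simp [Complex.mul_conj', hz]
    rw [diagonal_conjTranspose, diagonal_mul_diagonal, this]
    exact diagonal_one
  have hR : R * Rᴴ = 1 := by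
    simp only [R, conjTranspose_mul, conjTranspose_smul, conjTranspose_kronecker]
    rw [Matrix.mul_assoc, ← Matrix.mul_assoc (_ • _), smul_mul_smul_comm, ← mul_kronecker_mul, hss,
      smul_kronecker, kronecker_smul, one_kronecker_one, smul_smul, smul_smul]
    simp only [star_inv₀, star_ofNat]
    rw [show (2⁻¹ * 2⁻¹ * 2 * 2 : ℂ) = 1 by norm_num, one_smul, Matrix.one_mul, hzz]
  have hs2 : ∀ i k, (s ⊗ₖ s) i k ^ 2 = 1 := by
    rintro ⟨a, b⟩ ⟨c, d⟩
    fin_cases a <;> fin_cases b <;> fin_cases c <;> fin_cases d <;> simp [s]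
  refine ⟨fun k i => (V * R) i k, ?_, fun k => ?_⟩
  · rw [sum_pureState_col, conjTranspose_mul, Matrix.mul_assoc, ← Matrix.mul_assoc R, hR,
      Matrix.one_mul, h.eq_mul]
  · have : (V * R)ᵀ * spinY * (V * R) = Rᵀ * (Vᵀ * spinY * V * R) := by
      simp only [transpose_mul, Matrix.mul_assoc]
    rw [concForm_col, this, h.diag, mul_apply, Finset.sum_div]
    refine Finset.sum_congr rfl fun i _ => ?_
    have hRi : R i k = z i * (2⁻¹ * (s ⊗ₖ s) i k) := by
      simp only [R, diagonal_mul, Matrix.smul_apply, smul_eq_mul]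
    rw [transpose_apply, diagonal_mul, hRi]
    linear_combination (z i ^ 2 * l i / 4) * hs2 i k

theorem exists_norm_one_mul_eq_norm (w : ℂ) : ∃ u : ℂ, ‖u‖ = 1 ∧ u * w = ‖w‖ := by
  by_cases hw : w = 0
  · exact ⟨1, norm_one, by simp [hw]⟩
  · have hn : (‖w‖ : ℂ) ≠ 0 := by exact_mod_cast norm_ne_zero_iff.mpr hw
    refine ⟨starRingEnd ℂ w / ‖w‖, ?_, ?_⟩
    · rw [norm_div, Complex.norm_conj, Complex.norm_real, norm_norm,
        div_self (norm_ne_zero_iff.mpr hw)]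
    · rw [div_mul_eq_mul_div, Complex.conj_mul', pow_two, mul_div_assoc, div_self hn, mul_one]

/-- Intermediate value theorem for `|a + b e^{iθ}|` on `[0, π]`, then a rotation onto the real axis.
-/
theorem exists_phases_of_triangle {a b r : ℝ} (h1 : |a - b| ≤ r) (h2 : r ≤ a + b) :
    ∃ x y : ℂ, ‖x‖ = 1 ∧ ‖y‖ = 1 ∧ x * a + y * b = r := by
  let f : ℝ → ℝ := fun θ => ‖(a : ℂ) + b * Complex.exp (θ * Complex.I)‖
  have hf : Continuous f := by fun_prop
  have hπ : f Real.pi = |a - b| := by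
    simp only [f, Complex.exp_pi_mul_I]
    rw [← Real.norm_eq_abs, ← Complex.norm_real]
    push_cast
    ring_nf
  have h0 : f 0 = a + b := by
    simp only [f]
    rw [Complex.ofReal_zero, zero_mul, Complex.exp_zero, mul_one, ← Complex.ofReal_add,
      Complex.norm_real, Real.norm_of_nonneg ((abs_nonneg _).trans (h1.trans h2))]
  obtain ⟨θ, -, hθ⟩ := intermediate_value_Icc' Real.pi_pos.le hf.continuousOn
    (show r ∈ Set.Icc (f Real.pi) (f 0) by rw [hπ, h0]; exact ⟨h1, h2⟩)
  obtain ⟨u, hu, hur⟩ := exists_norm_one_mul_eq_norm ((a : ℂ) + b * Complex.exp (θ * Complex.I))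
  refine ⟨u, u * Complex.exp (θ * Complex.I), hu, ?_, ?_⟩
  · rw [norm_mul, hu, Complex.norm_exp_ofReal_mul_I, one_mul]
  · rw [← hθ, ← hur]; ring

/-- Four nonnegative lengths, the first of which is the largest and at most the sum of the others,
are the side lengths of a closed polygon. -/
theorem exists_phases_of_quadrilateral {a b c d : ℝ} (hb : 0 ≤ b) (hc : 0 ≤ c) (hd : 0 ≤ d)
    (hab : b ≤ a) (hac : c ≤ a) (had : d ≤ a) (h : a ≤ b + c + d) :
    ∃ x y z t : ℂ, ‖x‖ = 1 ∧ ‖y‖ = 1 ∧ ‖z‖ = 1 ∧ ‖t‖ = 1 ∧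
      x * a + y * b + z * c + t * d = 0 := by
  have hcd : |c - d| ≤ a := abs_le.mpr ⟨by linarith, by linarith⟩
  -- The quadrilateral is cut along a diagonal into two triangles; this `r` is a length admissible
  -- for both.
  obtain ⟨x, y, hx, hy, hxy⟩ := exists_phases_of_triangle (a := a) (b := b)
    (r := max (a - b) |c - d|) (by rw [abs_of_nonneg (by linarith)]; exact le_max_left _ _)
    (max_le (by linarith) (by linarith))
  obtain ⟨z, t, hz, ht, hzt⟩ := exists_phases_of_triangle (a := c) (b := d)
    (r := max (a - b) |c - d|) (le_max_right _ _)
    (max_le (by linarith) (abs_le.mpr ⟨by linarith, by linarith⟩))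
  refine ⟨x, y, -z, -t, hx, hy, by rwa [norm_neg], by rwa [norm_neg], ?_⟩
  linear_combination hxy - hzt

theorem exists_norm_one_sq_eq {x : ℂ} (hx : ‖x‖ = 1) : ∃ y : ℂ, ‖y‖ = 1 ∧ y ^ 2 = x := by
  obtain ⟨y, hy⟩ := IsAlgClosed.exists_pow_nat_eq x (n := 2) (by norm_num)
  refine ⟨y, ?_, hy⟩
  rw [← hy, norm_pow] at hx
  exact (pow_eq_one_iff_of_nonneg (norm_nonneg y) two_ne_zero).mp hx

theorem IsWoottersBasis.exists_decomposition_concForm_eq_zero {ρ V : TwoQubitMatrix}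
    {l : Fin 2 × Fin 2 → ℝ} (h : IsWoottersBasis ρ V l)
    (hl : l 0 - l (0, 1) - l (1, 0) - l (1, 1) ≤ 0) :
    ∃ w : Fin 2 × Fin 2 → Fin 2 × Fin 2 → ℂ,
      ρ = ∑ k, pureState (w k) ∧ ∀ k, concForm (w k) = 0 := by
  obtain ⟨x, y, z, t, hx, hy, hz, ht, hs⟩ := exists_phases_of_quadrilateral (h.nonneg (0, 1))
    (h.nonneg (1, 0)) (h.nonneg (1, 1)) (h.le_zero _) (h.le_zero _) (h.le_zero _) (by linarith)
  -- Square roots are taken because phases enter the decomposition squared.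
  obtain ⟨x, hx, rfl⟩ := exists_norm_one_sq_eq hx
  obtain ⟨y, hy, rfl⟩ := exists_norm_one_sq_eq hy
  obtain ⟨z, hz, rfl⟩ := exists_norm_one_sq_eq hz
  obtain ⟨t, ht, rfl⟩ := exists_norm_one_sq_eq ht
  obtain ⟨w, hw, hc⟩ := h.exists_decomposition_of_phases (fun i => !![x, y; z, t] i.1 i.2) (by
    rintro ⟨a, b⟩
    fin_cases a <;> fin_cases b <;> simpa)
  refine ⟨w, hw, fun k => ?_⟩
  rw [hc, div_eq_zero_iff]
  left
  rw [← hs]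
  simp [Fintype.sum_prod_type, ← Prod.zero_eq_mk]
  ring

/-! ### Entanglement entropy of pure states -/

theorem partialTraceB_pureState (φ : Fin 2 × Fin 2 → ℂ) :
    partialTraceB (pureState φ) =
      (of fun i j => φ (i, j) : Matrix (Fin 2) (Fin 2) ℂ) *
        (of fun i j => φ (i, j) : Matrix (Fin 2) (Fin 2) ℂ)ᴴ := by
  ext i j
  simp [partialTraceB, pureState, vecMulVec_apply, mul_apply]

/-- The reduced state is `M * Mᴴ` for the coefficient matrix `M` of `φ`: its eigenvalues have sum
`1` and product `|det M| ^ 2 = ‖concForm φ‖ ^ 2 / 4`. -/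
theorem entanglementEntropy_eq_binEntropy {φ : Fin 2 × Fin 2 → ℂ} (hφ : ∑ i, ‖φ i‖ ^ 2 = 1) :
    ∃ x : ℝ, 0 ≤ x ∧ x ≤ 1 ∧ 4 * (x * (1 - x)) = ‖concForm φ‖ ^ 2 ∧
      entanglementEntropy φ = Real.binEntropy x := by
  have hA := partialTraceB_pureState_isHermitian φ
  have hM := partialTraceB_pureState φ
  have hpos : (partialTraceB (pureState φ)).PosSemidef :=
    hM ▸ posSemidef_self_mul_conjTranspose _
  have hnn : ∀ i, 0 ≤ hA.eigenvalues i := hpos.eigenvalues_nonneg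
  have hsum : hA.eigenvalues 0 + hA.eigenvalues 1 = 1 := by
    have h1 := hA.trace_eq_sum_eigenvalues
    have h2 : (partialTraceB (pureState φ)).trace = ((∑ i, ‖φ i‖ ^ 2 : ℝ) : ℂ) := by
      rw [← trace_pureState]
      simp [trace, partialTraceB, Fintype.sum_prod_type]
    rw [h2, hφ, Fin.sum_univ_two] at h1
    exact Complex.ofReal_injective (by rw [Complex.ofReal_add]; exact h1.symm)
  have hprod : 4 * (hA.eigenvalues 0 * hA.eigenvalues 1) = ‖concForm φ‖ ^ 2 := by
    have h1 := hA.det_eq_prod_eigenvalues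
    rw [congrArg det hM, det_mul, det_conjTranspose, RCLike.star_def, Complex.mul_conj', det_fin_two,
      Fin.prod_univ_two] at h1
    have h2 : ‖φ (0, 0) * φ (1, 1) - φ (0, 1) * φ (1, 0)‖ ^ 2
        = hA.eigenvalues 0 * hA.eigenvalues 1 := by
      exact Complex.ofReal_injective (by rw [Complex.ofReal_pow, Complex.ofReal_mul]; exact h1)
    rw [← h2, concForm_eq, norm_mul, Complex.norm_ofNat, norm_sub_rev, mul_pow]
    norm_num
  have h1 : hA.eigenvalues 1 = 1 - hA.eigenvalues 0 := by linarith
  refine ⟨hA.eigenvalues 0, hnn 0, by linarith [hnn 1], h1 ▸ hprod, ?_⟩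
  rw [Real.binEntropy_eq_negMulLog_add_negMulLog_one_sub, ← h1, ← Fin.sum_univ_two fun i =>
    Real.negMulLog (hA.eigenvalues i)]
  rfl

theorem entanglementEntropy_le_log_two {φ : Fin 2 × Fin 2 → ℂ} (hφ : ∑ i, ‖φ i‖ ^ 2 = 1) :
    entanglementEntropy φ ≤ Real.log 2 := by
  obtain ⟨x, -, -, -, h⟩ := entanglementEntropy_eq_binEntropy hφ
  exact h ▸ Real.binEntropy_le_log_two

theorem entanglementEntropy_eq_log_two_iff {φ : Fin 2 × Fin 2 → ℂ} (hφ : ∑ i, ‖φ i‖ ^ 2 = 1) :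
    entanglementEntropy φ = Real.log 2 ↔ ‖concForm φ‖ = 1 := by
  obtain ⟨x, -, -, hx, h⟩ := entanglementEntropy_eq_binEntropy hφ
  rw [h, Real.binEntropy_eq_log_two, ← pow_eq_one_iff_of_nonneg (norm_nonneg _) two_ne_zero, ← hx]
  constructor
  · rintro rfl; norm_num
  · intro h
    have : (2 * x - 1) ^ 2 = 0 := by linarith
    rw [sq_eq_zero_iff] at this
    linarith

/-- From `log y ≤ y - 1`. This crude bound is convex in the concurrence, so it survives averaging.
-/
theorem norm_concForm_sq_le_entanglementEntropy {φ : Fin 2 × Fin 2 → ℂ}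
    (hφ : ∑ i, ‖φ i‖ ^ 2 = 1) : ‖concForm φ‖ ^ 2 / 2 ≤ entanglementEntropy φ := by
  obtain ⟨x, h0, h1, hx, h⟩ := entanglementEntropy_eq_binEntropy hφ
  have key : ∀ y : ℝ, 0 ≤ y → y * (1 - y) ≤ Real.negMulLog y := by
    intro y hy
    rcases hy.eq_or_lt with rfl | hy
    · simp
    · rw [Real.negMulLog]
      nlinarith [Real.log_le_sub_one_of_pos hy]
  rw [h, Real.binEntropy_eq_negMulLog_add_negMulLog_one_sub, ← hx]
  linarith [key x h0, key (1 - x) (by linarith)]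

theorem entanglementEntropy_nonneg {φ : Fin 2 × Fin 2 → ℂ} (hφ : ∑ i, ‖φ i‖ ^ 2 = 1) :
    0 ≤ entanglementEntropy φ :=
  le_trans (by positivity) (norm_concForm_sq_le_entanglementEntropy hφ)

theorem entanglementEntropy_eq_zero {φ : Fin 2 × Fin 2 → ℂ} (hφ : ∑ i, ‖φ i‖ ^ 2 = 1)
    (hc : concForm φ = 0) : entanglementEntropy φ = 0 := by
  obtain ⟨x, -, -, hx, h⟩ := entanglementEntropy_eq_binEntropy hφ
  rw [hc, norm_zero, zero_pow two_ne_zero, mul_eq_zero, mul_eq_zero] at hx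
  rw [h, Real.binEntropy_eq_zero]
  rcases hx with hx | hx | hx
  · norm_num at hx
  · exact Or.inl hx
  · right; linarith

/-! ### Entanglement of formation -/

theorem exists_isPureDecomposition {ρ : TwoQubitMatrix} (hρ : ρ.trace = 1) {ι : Type*} [Fintype ι]
    {w : ι → Fin 2 × Fin 2 → ℂ} (hw : ρ = ∑ k, pureState (w k)) :
    ∃ (K : ℕ) (p : Fin K → ℝ) (φ : Fin K → Fin 2 × Fin 2 → ℂ) (e : Fin K ≃ ι),
      IsPureDecomposition ρ p φ ∧ ∀ k, p k * ‖concForm (φ k)‖ = ‖concForm (w (e k))‖ := by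
  have key : ∀ v : Fin 2 × Fin 2 → ℂ, ∃ ψ : Fin 2 × Fin 2 → ℂ, ∑ i, ‖ψ i‖ ^ 2 = 1 ∧
      v = ((√(∑ i, ‖v i‖ ^ 2) : ℝ) : ℂ) • ψ := by
    intro v
    set s : ℝ := ∑ i, ‖v i‖ ^ 2 with hs
    have hs0 : 0 ≤ s := by positivity
    rcases hs0.eq_or_lt with h0 | h0
    -- A zero vector gets weight zero, so any unit vector serves.
    · refine ⟨Pi.single 0 1, ?_, ?_⟩
      · rw [Finset.sum_eq_single 0 (fun i _ hi => by simp [Pi.single_eq_of_ne hi]) (by simp)]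
        simp
      · rw [← h0, Real.sqrt_zero, Complex.ofReal_zero, zero_smul]
        ext i
        have := (Finset.sum_eq_zero_iff_of_nonneg fun j _ => by positivity).mp
          (hs.symm.trans h0.symm) i (Finset.mem_univ i)
        simpa using this
    · have hq : 0 < √s := Real.sqrt_pos.mpr h0
      refine ⟨((√s)⁻¹ : ℝ) • v, ?_, ?_⟩
      · simp only [Pi.smul_apply, norm_smul, mul_pow, ← Finset.mul_sum]
        rw [← hs, Real.norm_of_nonneg (by positivity), inv_pow, Real.sq_sqrt hs0,
          inv_mul_cancel₀ h0.ne']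
      · ext i
        have : ((√s : ℝ) : ℂ) ≠ 0 := by exact_mod_cast hq.ne'
        simp [this]
  choose ψ hψ1 hψ using fun k => key (w k)
  let e := (Fintype.equivFin ι).symm
  have hn : ∀ k : ι, ‖((√(∑ i, ‖w k i‖ ^ 2) : ℝ) : ℂ)‖ ^ 2 = ∑ i, ‖w k i‖ ^ 2 := fun k => by
    rw [Complex.norm_real, Real.norm_eq_abs, sq_abs, Real.sq_sqrt (by positivity)]
  refine ⟨_, fun k => ∑ i, ‖w (e k) i‖ ^ 2, fun k => ψ (e k), e,
    ⟨fun k => by positivity, ?_, fun k => hψ1 _, ?_⟩, fun k => ?_⟩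
  · rw [e.sum_comp fun k => ∑ i, ‖w k i‖ ^ 2]
    rw [hw, trace_sum] at hρ
    simp only [trace_pureState] at hρ
    exact_mod_cast hρ
  · rw [e.sum_comp fun k => ((∑ i, ‖w k i‖ ^ 2 : ℝ) : ℂ) • pureState (ψ k), hw]
    refine Finset.sum_congr rfl fun k _ => ?_
    rw [← hn, ← pureState_smul, ← hψ]
  · beta_reduce
    rw [← hn, ← norm_pow, ← norm_mul, ← concForm_smul, ← hψ]

namespace IsPureDecomposition

variable {ρ : TwoQubitMatrix} {K : ℕ} {p : Fin K → ℝ} {φ : Fin K → Fin 2 × Fin 2 → ℂ}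

theorem entanglementOfFormation_le (h : IsPureDecomposition ρ p φ) :
    entanglementOfFormation ρ ≤ ∑ k, p k * entanglementEntropy (φ k) := by
  refine csInf_le ⟨0, ?_⟩ ⟨K, p, φ, h, rfl⟩
  rintro e ⟨K, p, φ, h, rfl⟩
  exact Finset.sum_nonneg fun k _ => mul_nonneg (h.1 k) (entanglementEntropy_nonneg (h.2.2.1 k))

theorem exists_sum_pureState (h : IsPureDecomposition ρ p φ) :
    ∃ w : Fin K → Fin 2 × Fin 2 → ℂ, ρ = ∑ k, pureState (w k) ∧
      ∀ k, ‖concForm (w k)‖ = p k * ‖concForm (φ k)‖ := by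
  have hn : ∀ k, ‖((√(p k) : ℝ) : ℂ)‖ ^ 2 = p k := fun k => by
    rw [Complex.norm_real, Real.norm_eq_abs, sq_abs, Real.sq_sqrt (h.1 k)]
  refine ⟨fun k => ((√(p k) : ℝ) : ℂ) • φ k, ?_, fun k => ?_⟩
  · simp only [pureState_smul, hn]
    exact h.2.2.2
  · rw [concForm_smul, norm_mul, norm_pow, hn]

theorem norm_concForm_le_one (h : IsPureDecomposition ρ p φ) (k : Fin K) :
    ‖concForm (φ k)‖ ≤ 1 :=
  (norm_concForm_le _).trans (h.2.2.1 k).le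

end IsPureDecomposition

theorem le_entanglementOfFormation {ρ : TwoQubitMatrix} (hρ : IsDensityMatrix ρ) {b : ℝ}
    (h : ∀ (K : ℕ) (p : Fin K → ℝ) (φ : Fin K → Fin 2 × Fin 2 → ℂ), IsPureDecomposition ρ p φ →
      b ≤ ∑ k, p k * entanglementEntropy (φ k)) : b ≤ entanglementOfFormation ρ := by
  -- The columns of `V` show that the set of averages is nonempty, as a lower bound for `sInf`
  -- requires.
  obtain ⟨V, hV⟩ := hρ.1.exists_eq_mul_conjTranspose
  obtain ⟨K, p, φ, -, hd, -⟩ := exists_isPureDecomposition hρ.2 (hV.trans (sum_pureState_col V).symm)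
  refine le_csInf ⟨_, K, p, φ, hd, rfl⟩ ?_
  rintro e ⟨K, p, φ, hd, rfl⟩
  exact h K p φ hd

theorem entanglementOfFormation_nonneg {ρ : TwoQubitMatrix} (hρ : IsDensityMatrix ρ) :
    0 ≤ entanglementOfFormation ρ :=
  le_entanglementOfFormation hρ fun _ _ _ h => Finset.sum_nonneg fun k _ =>
    mul_nonneg (h.1 k) (entanglementEntropy_nonneg (h.2.2.1 k))

theorem entanglementOfFormation_le_log_two {ρ : TwoQubitMatrix} (hρ : IsDensityMatrix ρ) :
    entanglementOfFormation ρ ≤ Real.log 2 := by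
  obtain ⟨V, hV⟩ := hρ.1.exists_eq_mul_conjTranspose
  obtain ⟨K, p, φ, -, hd, -⟩ := exists_isPureDecomposition hρ.2 (hV.trans (sum_pureState_col V).symm)
  refine hd.entanglementOfFormation_le.trans ?_
  calc _ ≤ ∑ k, p k * Real.log 2 := Finset.sum_le_sum fun k _ =>
        mul_le_mul_of_nonneg_left (entanglementEntropy_le_log_two (hd.2.2.1 k)) (hd.1 k)
    _ = Real.log 2 := by rw [← Finset.sum_mul, hd.2.1, one_mul]

theorem entanglementOfFormation_eq_zero {ρ : TwoQubitMatrix} (hρ : IsDensityMatrix ρ) {ι : Type*}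
    [Fintype ι] {w : ι → Fin 2 × Fin 2 → ℂ} (hw : ρ = ∑ k, pureState (w k))
    (hc : ∀ k, concForm (w k) = 0) : entanglementOfFormation ρ = 0 := by
  obtain ⟨K, p, φ, e, hd, hp⟩ := exists_isPureDecomposition hρ.2 hw
  refine le_antisymm (hd.entanglementOfFormation_le.trans (le_of_eq ?_))
    (entanglementOfFormation_nonneg hρ)
  refine Finset.sum_eq_zero fun k _ => ?_
  have := hp k
  rw [hc, norm_zero, mul_eq_zero, norm_eq_zero] at this
  rcases this with h | h
  · rw [h, zero_mul]
  · rw [entanglementEntropy_eq_zero (hd.2.2.1 k) h, mul_zero]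

/-- No entropy exceeds `log 2` and the average is at least `log 2`, so each state of positive weight
has entropy `log 2`, hence concurrence `1`. -/
theorem sum_norm_concForm_eq_one {ρ : TwoQubitMatrix} (hρ : IsDensityMatrix ρ)
    (hE : Real.log 2 ≤ entanglementOfFormation ρ) {ι : Type*}
    [Fintype ι] {w : ι → Fin 2 × Fin 2 → ℂ} (hw : ρ = ∑ k, pureState (w k)) :
    ∑ k, ‖concForm (w k)‖ = 1 := by
  obtain ⟨K, p, φ, e, hd, hp⟩ := exists_isPureDecomposition hρ.2 hw
  rw [← e.sum_comp, ← hd.2.1]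
  refine Finset.sum_congr rfl fun k _ => ?_
  rw [← hp]
  have h0 : ∀ k ∈ Finset.univ, 0 ≤ p k * (Real.log 2 - entanglementEntropy (φ k)) := fun k _ =>
    mul_nonneg (hd.1 k) (sub_nonneg.mpr (entanglementEntropy_le_log_two (hd.2.2.1 k)))
  have h1 : ∑ k, p k * (Real.log 2 - entanglementEntropy (φ k)) ≤ 0 := by
    simp only [mul_sub, Finset.sum_sub_distrib]
    rw [← Finset.sum_mul, hd.2.1, one_mul, sub_nonpos]
    exact hE.trans hd.entanglementOfFormation_le
  have h2 := (Finset.sum_eq_zero_iff_of_nonneg h0).mp (le_antisymm h1 (Finset.sum_nonneg h0)) k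
    (Finset.mem_univ k)
  rcases mul_eq_zero.mp h2 with h | h
  · rw [h, zero_mul]
  · rw [(entanglementEntropy_eq_log_two_iff (hd.2.2.1 k)).mp (sub_eq_zero.mp h).symm, mul_one]

namespace IsWoottersBasis

variable {ρ V : TwoQubitMatrix} {l : Fin 2 × Fin 2 → ℝ}

theorem le_sum_mul_norm_concForm (h : IsWoottersBasis ρ V l) {K : ℕ} {p : Fin K → ℝ}
    {φ : Fin K → Fin 2 × Fin 2 → ℂ} (hd : IsPureDecomposition ρ p φ) :
    l 0 - l (0, 1) - l (1, 0) - l (1, 1) ≤ ∑ k, p k * ‖concForm (φ k)‖ := by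
  obtain ⟨w, hw, hc⟩ := hd.exists_sum_pureState
  simp only [← hc]
  exact h.le_sum_norm_concForm hw

theorem sq_le_entanglementOfFormation (h : IsWoottersBasis ρ V l) (hρ : IsDensityMatrix ρ)
    (hl : 0 ≤ l 0 - l (0, 1) - l (1, 0) - l (1, 1)) :
    (l 0 - l (0, 1) - l (1, 0) - l (1, 1)) ^ 2 / 2 ≤ entanglementOfFormation ρ := by
  refine le_entanglementOfFormation hρ fun K p φ hd => ?_
  have hC := h.le_sum_mul_norm_concForm hd
  set C := l 0 - l (0, 1) - l (1, 0) - l (1, 1)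
  -- Jensen's inequality through the tangent line of `c ^ 2 / 2` at `C`.
  calc C ^ 2 / 2 ≤ C * ∑ k, p k * ‖concForm (φ k)‖ - C ^ 2 / 2 * ∑ k, p k := by
        rw [hd.2.1]; nlinarith
    _ = ∑ k, p k * (C * ‖concForm (φ k)‖ - C ^ 2 / 2) := by
        rw [Finset.mul_sum, Finset.mul_sum, ← Finset.sum_sub_distrib]
        exact Finset.sum_congr rfl fun k _ => by ring
    _ ≤ _ := Finset.sum_le_sum fun k _ => mul_le_mul_of_nonneg_left
        (le_trans (by nlinarith [sq_nonneg (C - ‖concForm (φ k)‖)])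
          (norm_concForm_sq_le_entanglementEntropy (hd.2.2.1 k))) (hd.1 k)

theorem log_two_le_entanglementOfFormation (h : IsWoottersBasis ρ V l) (hρ : IsDensityMatrix ρ)
    (hl : 1 ≤ l 0 - l (0, 1) - l (1, 0) - l (1, 1)) :
    Real.log 2 ≤ entanglementOfFormation ρ := by
  refine le_entanglementOfFormation hρ fun K p φ hd => ?_
  have h0 : ∀ k ∈ Finset.univ, 0 ≤ p k * (1 - ‖concForm (φ k)‖) := fun k _ =>
    mul_nonneg (hd.1 k) (sub_nonneg.mpr (hd.norm_concForm_le_one k))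
  have h1 : ∑ k, p k * (1 - ‖concForm (φ k)‖) ≤ 0 := by
    simp only [mul_sub, Finset.sum_sub_distrib, mul_one]
    rw [hd.2.1, sub_nonpos]
    exact hl.trans (h.le_sum_mul_norm_concForm hd)
  have h2 := (Finset.sum_eq_zero_iff_of_nonneg h0).mp (le_antisymm h1 (Finset.sum_nonneg h0))
  rw [← one_mul (Real.log 2), ← hd.2.1, Finset.sum_mul]
  refine Finset.sum_le_sum fun k hk => le_of_eq ?_
  rcases mul_eq_zero.mp (h2 k hk) with h | h
  · rw [h, zero_mul, zero_mul]
  · rw [(entanglementEntropy_eq_log_two_iff (hd.2.2.1 k)).mpr (sub_eq_zero.mp h).symm]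

/-- Each `l i` is the concurrence of column `i`, at most its squared norm; these norms add up to the
trace. -/
theorem sum_le_one (h : IsWoottersBasis ρ V l) (hρ : IsDensityMatrix ρ) : ∑ i, l i ≤ 1 := by
  have h1 : ∑ i, ∑ j, ‖V j i‖ ^ 2 = 1 := by
    have := hρ.2
    rw [h.eq_mul, ← sum_pureState_col, trace_sum] at this
    simp only [trace_pureState] at this
    exact_mod_cast this
  rw [← h1]
  refine Finset.sum_le_sum fun i _ => ?_
  have h2 := norm_concForm_le fun j => V j i
  rwa [concForm_col, h.diag, diagonal_apply_eq, Complex.norm_real,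
    Real.norm_of_nonneg (h.nonneg i)] at h2

theorem harmony_eq (h : IsWoottersBasis ρ V l) : harmony ρ =
    max 0 ((l 0 - l (0, 1) - l (1, 0) - l (1, 1)) * (l 0 + l (0, 1) + l (1, 0) - l (1, 1)) *
        (l 0 + l (0, 1) - l (1, 0) + l (1, 1)) * (l 0 - l (0, 1) + l (1, 0) + l (1, 1))) := by
  rw [harmony, h.harmonyPoly_eq, Complex.ofReal_re]

theorem harmony_eq_zero_iff (h : IsWoottersBasis ρ V l) :
    harmony ρ = 0 ↔ l 0 - l (0, 1) - l (1, 0) - l (1, 1) ≤ 0 := by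
  have hb := h.nonneg (0, 1)
  have hc := h.nonneg (1, 0)
  have hd := h.nonneg (1, 1)
  have h1 := h.le_zero (0, 1)
  have h2 := h.le_zero (1, 0)
  have h3 := h.le_zero (1, 1)
  rw [h.harmony_eq, max_eq_left_iff]
  constructor
  · intro hn
    by_contra! hp
    refine hn.not_gt (mul_pos (mul_pos (mul_pos hp ?_) ?_) ?_) <;> linarith
  · intro hn
    refine mul_nonpos_of_nonpos_of_nonneg (mul_nonpos_of_nonpos_of_nonneg
      (mul_nonpos_of_nonpos_of_nonneg hn ?_) ?_) ?_ <;> linarith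

theorem one_le_of_harmony_eq_one (h : IsWoottersBasis ρ V l) (hρ : IsDensityMatrix ρ)
    (hH : harmony ρ = 1) : 1 ≤ l 0 - l (0, 1) - l (1, 0) - l (1, 1) := by
  have hb := h.nonneg (0, 1)
  have hc := h.nonneg (1, 0)
  have hd := h.nonneg (1, 1)
  have hC : 0 < l 0 - l (0, 1) - l (1, 0) - l (1, 1) := by
    by_contra! hn
    rw [h.harmony_eq_zero_iff.mpr hn] at hH
    exact zero_ne_one hH
  have hs := h.sum_le_one hρ
  simp only [Fintype.sum_prod_type, Fin.sum_univ_two] at hs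
  rw [← Prod.zero_eq_mk] at hs
  have h1 : (l 0 - l (0, 1) - l (1, 0) - l (1, 1)) * (l 0 + l (0, 1) + l (1, 0) - l (1, 1)) *
      (l 0 + l (0, 1) - l (1, 0) + l (1, 1)) * (l 0 - l (0, 1) + l (1, 0) + l (1, 1)) = 1 := by
    rw [h.harmony_eq] at hH
    rcases max_choice (0 : ℝ) ((l 0 - l (0, 1) - l (1, 0) - l (1, 1)) *
      (l 0 + l (0, 1) + l (1, 0) - l (1, 1)) * (l 0 + l (0, 1) - l (1, 0) + l (1, 1)) *
      (l 0 - l (0, 1) + l (1, 0) + l (1, 1))) with h | h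
    · rw [h] at hH; exact absurd hH zero_ne_one
    · rwa [h] at hH
  rw [← h1]
  have hm : ∀ x y : ℝ, 0 ≤ x → y ≤ 1 → x * y ≤ x := fun x y => mul_le_of_le_one_right
  have p1 : 0 ≤ l 0 + l (0, 1) + l (1, 0) - l (1, 1) := by linarith
  have p2 : 0 ≤ l 0 + l (0, 1) - l (1, 0) + l (1, 1) := by linarith
  exact ((hm _ _ (mul_nonneg (mul_nonneg hC.le p1) p2) (by linarith)).trans
    (hm _ _ (mul_nonneg hC.le p1) (by linarith))).trans (hm _ _ hC.le (by linarith))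

theorem harmony_eq_one_of_log_two_le (h : IsWoottersBasis ρ V l) (hρ : IsDensityMatrix ρ)
    (hE : Real.log 2 ≤ entanglementOfFormation ρ) : harmony ρ = 1 := by
  have key : ∀ z : Fin 2 × Fin 2 → ℂ, (∀ i, ‖z i‖ = 1) → ‖∑ i, z i ^ 2 * l i‖ = 1 := by
    intro z hz
    obtain ⟨w, hw, hc⟩ := h.exists_decomposition_of_phases z hz
    have := sum_norm_concForm_eq_one hρ hE hw
    simp only [hc, norm_div, Finset.sum_const, Finset.card_univ, Fintype.card_prod,
      Fintype.card_fin, Complex.norm_ofNat] at this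
    norm_num at this
    linarith
  have h1 := key 1 (by simp)
  -- The phase `I` squares to `-1`: together `h1` and `h2` give `∑ l i = 1` and `|C| = 1`.
  have h2 := key (fun i => if i = 0 then 1 else Complex.I) (fun i => by split_ifs <;> simp)
  simp only [Fintype.sum_prod_type, Fin.sum_univ_two, ← Prod.zero_eq_mk] at h1 h2
  simp [Prod.ext_iff] at h1 h2
  replace h1 : |l 0 + l (0, 1) + (l (1, 0) + l (1, 1))| = 1 := by
    rw [← h1, ← Real.norm_eq_abs, ← Complex.norm_real]
    push_cast
    rfl
  replace h2 : |l 0 + -l (0, 1) + (-l (1, 0) + -l (1, 1))| = 1 := by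
    rw [← h2, ← Real.norm_eq_abs, ← Complex.norm_real]
    push_cast
    rfl
  have ha := h.nonneg 0
  have hb := h.nonneg (0, 1)
  have hc := h.nonneg (1, 0)
  have hd := h.nonneg (1, 1)
  have hb' := h.le_zero (0, 1)
  have hc' := h.le_zero (1, 0)
  have hd' := h.le_zero (1, 1)
  rw [abs_of_nonneg (by linarith)] at h1
  rcases eq_or_eq_neg_of_abs_eq h2 with h2 | h2
  · rw [h.harmony_eq, show l (0, 1) = 0 by linarith, show l (1, 0) = 0 by linarith,
      show l (1, 1) = 0 by linarith, show l 0 = 1 by linarith]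
    norm_num
  -- `C = -1` would force `l 0 = 0`, although `l 0` is the largest of values with sum `1`.
  · linarith

end IsWoottersBasis

/-! ### Separable states -/

theorem isDensityMatrix_mul_conjTranspose {φ : Fin 2 × Fin 2 → ℂ} (hφ : ∑ i, ‖φ i‖ ^ 2 = 1)
    (M : Matrix (Fin 2) (Fin 2) ℂ) (hM : (∀ i j, M i j = φ (i, j)) ∨ ∀ i j, M i j = φ (j, i)) :
    IsDensityMatrix (M * Mᴴ) := by
  refine ⟨posSemidef_self_mul_conjTranspose _, ?_⟩
  have h1 : (M * Mᴴ).trace = ((∑ i, ∑ j, ‖M i j‖ ^ 2 : ℝ) : ℂ) := by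
    simp [trace, mul_apply, Complex.mul_conj']
  rw [h1, ← Complex.ofReal_one, ← hφ, Fintype.sum_prod_type]
  rcases hM with h | h
  · simp only [h]
  · simp only [h]
    rw [Finset.sum_comm]

/-- Zero concurrence means that the coefficient matrix has rank at most one, which is the exchange
rule `hdet`. The factors are the reduced states, so no product vector need be extracted. -/
theorem pureState_eq_kronecker {φ : Fin 2 × Fin 2 → ℂ} (hφ : ∑ i, ‖φ i‖ ^ 2 = 1)
    (hc : concForm φ = 0) : ∃ α β : Matrix (Fin 2) (Fin 2) ℂ, IsDensityMatrix α ∧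
      IsDensityMatrix β ∧ pureState φ = α ⊗ₖ β := by
  let M : Matrix (Fin 2) (Fin 2) ℂ := of fun i j => φ (i, j)
  let N : Matrix (Fin 2) (Fin 2) ℂ := of fun i j => φ (j, i)
  refine ⟨M * Mᴴ, N * Nᴴ, isDensityMatrix_mul_conjTranspose hφ M (Or.inl fun _ _ => rfl),
    isDensityMatrix_mul_conjTranspose hφ N (Or.inr fun _ _ => rfl), ?_⟩
  have hdet : ∀ i k m j, φ (i, k) * φ (m, j) = φ (i, j) * φ (m, k) := by
    rw [concForm_eq] at hc
    simp only [Fin.forall_fin_two]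
    repeat' apply And.intro
    all_goals first
      | trivial
      | ring1
      | linear_combination hc / 2
      | linear_combination -hc / 2
  have hn : ∑ k, ∑ m, φ (m, k) * star (φ (m, k)) = 1 := by
    have : ((∑ i, ‖φ i‖ ^ 2 : ℝ) : ℂ) = 1 := by rw [hφ, Complex.ofReal_one]
    rw [← this, Fintype.sum_prod_type, Finset.sum_comm]
    push_cast
    simp only [RCLike.star_def, Complex.mul_conj']
  ext ⟨i, j⟩ ⟨i', j'⟩
  simp only [pureState, vecMulVec_apply, Pi.star_apply, kroneckerMap_apply, mul_apply,
    conjTranspose_apply, M, N, of_apply, Finset.sum_mul_sum]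
  -- Inserting `‖φ‖ ^ 2 = 1` makes both sides double sums that agree termwise by `hdet`.
  rw [← mul_one (φ (i, j) * _), ← hn, Finset.mul_sum]
  refine Finset.sum_congr rfl fun k _ => ?_
  rw [Finset.mul_sum]
  refine Finset.sum_congr rfl fun m _ => ?_
  have h2 := congrArg star (hdet i' k m j')
  rw [star_mul', star_mul'] at h2
  linear_combination (-(star (φ (i', k)) * star (φ (m, j')))) * hdet i k m j
    - (φ (i, j) * φ (m, k)) * h2

theorem isSeparableState_of_concForm_eq_zero {ρ : TwoQubitMatrix} (hρ : ρ.trace = 1) {ι : Type*}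
    [Fintype ι] {w : ι → Fin 2 × Fin 2 → ℂ} (hw : ρ = ∑ k, pureState (w k))
    (hc : ∀ k, concForm (w k) = 0) : IsSeparableState ρ := by
  obtain ⟨K, p, φ, e, hd, hp⟩ := exists_isPureDecomposition hρ hw
  have key : ∀ k, ∃ α β : Matrix (Fin 2) (Fin 2) ℂ, IsDensityMatrix α ∧ IsDensityMatrix β ∧
      (p k : ℂ) • pureState (φ k) = (p k : ℂ) • (α ⊗ₖ β) := by
    intro k
    have := hp k
    rw [hc, norm_zero, mul_eq_zero, norm_eq_zero] at this
    rcases this with h | h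
    · have hs : IsDensityMatrix (diagonal ![1, 0] : Matrix (Fin 2) (Fin 2) ℂ) := by
        refine ⟨PosSemidef.diagonal fun i => ?_, by simp [trace_diagonal]⟩
        fin_cases i <;> simp
      exact ⟨_, _, hs, hs, by rw [h, Complex.ofReal_zero, zero_smul, zero_smul]⟩
    · obtain ⟨α, β, hα, hβ, hk⟩ := pureState_eq_kronecker (hd.2.2.1 k) h
      exact ⟨α, β, hα, hβ, by rw [hk]⟩
  choose α β hα hβ hk using key
  exact ⟨K, p, α, β, hd.1, hd.2.1, hα, hβ, hd.2.2.2.trans (Finset.sum_congr rfl fun k _ => hk k)⟩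

/-- Factoring `α = A * Aᴴ` and `β = B * Bᴴ`, the columns of `A ⊗ₖ B` are product vectors. -/
theorem IsSeparableState.exists_sum_pureState {ρ : TwoQubitMatrix} (h : IsSeparableState ρ) :
    ∃ (K : ℕ) (w : Fin K × Fin 2 × Fin 2 → Fin 2 × Fin 2 → ℂ), ρ = ∑ k, pureState (w k) ∧
      ∀ k, concForm (w k) = 0 := by
  obtain ⟨K, p, α, β, hp, -, hα, hβ, hρ⟩ := h
  choose A hA using fun k => (hα k).1.exists_eq_mul_conjTranspose
  choose B hB using fun k => (hβ k).1.exists_eq_mul_conjTranspose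
  refine ⟨K, fun k => ((√(p k.1) : ℝ) : ℂ) • fun i => (A k.1 ⊗ₖ B k.1) i k.2, ?_, fun k => ?_⟩
  · rw [hρ, Fintype.sum_prod_type]
    refine Finset.sum_congr rfl fun k _ => ?_
    simp only [pureState_smul]
    rw [← Finset.smul_sum, sum_pureState_col, conjTranspose_kronecker, ← mul_kronecker_mul, ← hA,
      ← hB, Complex.norm_real, Real.norm_eq_abs, sq_abs, Real.sq_sqrt (hp k)]
  · rw [concForm_smul, concForm_eq]
    simp only [kroneckerMap_apply]
    ring

/-! ### The singlet-type state with concurrence one -/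

theorem exists_isWoottersBasis_of_maximal : ∃ (τ V : TwoQubitMatrix) (l : Fin 2 × Fin 2 → ℝ),
    IsDensityMatrix τ ∧ IsWoottersBasis τ V l ∧ 1 ≤ l 0 - l (0, 1) - l (1, 0) - l (1, 1) := by
  let r : ℂ := ((√2)⁻¹ : ℝ)
  have hr : r * r = 1 / 2 := by
    simp only [r]
    rw [← Complex.ofReal_mul, ← mul_inv, Real.mul_self_sqrt (by norm_num)]
    norm_num
  have hrs : star r = r := Complex.conj_ofReal _
  -- The only nonzero column is `(|01⟩ + |10⟩)/√2`; with the minus sign of the singlet the form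
  -- would be `-1` instead of `1`.
  let V : TwoQubitMatrix := of fun i j => if j = 0 ∧ i.1 ≠ i.2 then r else 0
  refine ⟨V * Vᴴ, V, fun i => if i = 0 then 1 else 0, ⟨posSemidef_self_mul_conjTranspose _, ?_⟩,
    ⟨rfl, ?_, fun i => by split_ifs <;> norm_num,
      fun i => by rw [if_pos rfl]; split_ifs <;> norm_num⟩, ?_⟩
  · simp [trace, mul_apply, V, Fintype.sum_prod_type, Prod.ext_iff]
    rw [← RCLike.star_def, hrs, hr]
    norm_num
  · ext ⟨a, b⟩ ⟨c, d⟩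
    fin_cases a <;> fin_cases b <;> fin_cases c <;> fin_cases d <;>
      simp [mul_apply, V, Fintype.sum_prod_type, spinY, pauliY, diagonal]
    rw [hr]
    norm_num
  · simp [Prod.ext_iff]

theorem mainTheorem1 (ρ : TwoQubitMatrix) (hρ : IsDensityMatrix ρ) :
    ((IsSeparableState ρ ↔ harmony ρ = 0) ∧ (entanglementOfFormation ρ = 0 ↔ harmony ρ = 0)) ∧
    (IsMaximallyEntangled ρ ↔ harmony ρ = 1) := by
  obtain ⟨V, l, h⟩ := exists_isWoottersBasis hρ.1
  refine ⟨⟨⟨fun hs => ?_, fun hH => ?_⟩, fun hE => ?_, fun hH => ?_⟩, fun hm => ?_, fun hH => ?_⟩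
  · obtain ⟨K, w, hw, hc⟩ := hs.exists_sum_pureState
    rw [h.harmony_eq_zero_iff]
    simpa [hc] using h.le_sum_norm_concForm hw
  · obtain ⟨w, hw, hc⟩ :=
      h.exists_decomposition_concForm_eq_zero (h.harmony_eq_zero_iff.mp hH)
    exact isSeparableState_of_concForm_eq_zero hρ.2 hw hc
  · rw [h.harmony_eq_zero_iff]
    by_contra! hp
    have := h.sq_le_entanglementOfFormation hρ hp.le
    rw [hE] at this
    exact this.not_gt (by positivity)
  · obtain ⟨w, hw, hc⟩ :=
      h.exists_decomposition_concForm_eq_zero (h.harmony_eq_zero_iff.mp hH)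
    exact entanglementOfFormation_eq_zero hρ hw hc
  · obtain ⟨τ, U, m, hτ, hU, h1⟩ := exists_isWoottersBasis_of_maximal
    exact h.harmony_eq_one_of_log_two_le hρ
      ((hU.log_two_le_entanglementOfFormation hτ h1).trans (hm.2 τ hτ))
  · exact ⟨hρ, fun τ hτ => (entanglementOfFormation_le_log_two hτ).trans
      (h.log_two_le_entanglementOfFormation hρ (h.one_le_of_harmony_eq_one hρ hH))⟩
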